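/- Let $K\neq 0$ be a commutative ring with unit, let $\lambda\in K$, and let $X$ be a well-ordered set. Algebras are commutative and not assumed to have a unit. A commutative $\lambda$-differential algebra is a commutative $K$-algebra $R$ with a $K$-linear map $D:R\to R$ such that $D(uv)=D(u)v+uD(v)+\lambda D(u)D(v)$ for all $u,v\in R$. Let $\mathcal Q(X)$ be the set of commutative words on $X$ with one unary operator $D$, i.e. the commutative semigroup (without identity) with a unary operator $D$ freely generated by $X$; every $u\in\mathcal Q(X)$ is, uniquely up to order, a product $u=u_1\cdots u_n$, $n\ge 1$, with factors $u_i\in X\cup D(\mathcal Q(X))$. Let $K[X;D]$ be the $K$-algebra with $K$-basis $\mathcal Q(X)$, whose product and operator $D$ extend those of $\mathcal Q(X)$ linearly. Let $\deg(u)$ be the number of occurrences of letters of $X$ in $u$. Order $\mathcal Q(X)$ recursively on the nesting depth of $D$: factors are ordered by the order of $X$ on $X$, by $x<D(a)$ for $x\in X$, and by $D(a)<D(b)\iff a<b$; and for words $u=w_1^{i_1}\cdots w_t^{i_t}$, $v=w_1^{j_1}\cdots w_t^{j_t}$ with factors $w_1>\cdots>w_t$ and exponents $\ge 0$, put $u<v$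 iff $(\deg u,i_1,\dots,i_t)<(\deg v,j_1,\dots,j_t)$ lexicographically. Write $\bar f$ for the leading (greatest) word of $0\ne f\in K[X;D]$. Let $$S=\{D(uv)-D(u)v-uD(v)-\lambda D(u)D(v)\mid u,v\in\mathcal Q(X)\},$$ let $\mathrm{Id}(S)$ be the smallest ideal of $K[X;D]$ that contains $S$ and is closed under $D$, and let $K[X;D|S]=K[X;D]/\mathrm{Id}(S)$ with the induced operator $D$. Let $\mathrm{Irr}(S)$ be the set of $w\in\mathcal Q(X)$ that are not of the form $u|_{\bar s}$, where $s\in S$, $u$ is a word on $X\cup\{\star\}$ with exactly one occurrence of $\star$, and $u|_{\bar s}$ is $u$ with $\star$ replaced by $\bar s$. Let $CS(D^\omega(X))\subseteq\mathcal Q(X)$ be the set of commutative monomials in the letters $D^i(x)$, $i\ge 0$, $x\in X$ (with at least one factor); it is the free commutative semigroup on these letters. Then $\mathrm{Irr}(S)=CS(D^\omega(X))$, and the images of the elements of $CS(D^\omega(X))$ form a $K$-basis of $K[X;D|S]$. Moreover $K[X;D|S]$ is the free commutative $\lambda$-differential algebra on $X$: it is a commutative $\lambda$-differential algebra, and for every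 commutative $\lambda$-differential $K$-algebra $(R,d)$ and every map $\varphi:X\to R$ there is a unique $K$-algebra homomorphism $f:K[X;D|S]\to R$ with $f\circ D=d\circ f$ and $f(x)=\varphi(x)$ for all $x\in X$. -/

import Mathlib

namespace CommDiff

/-! ### Commutative words with one unary operator `D` -/

/-- Formal expressions built from the letters of `X`, a unary operator symbol `D` (`op`),
and a binary product. There is no empty expression. -/
inductive Raw (X : Type*) where
  | var : X → Raw X
  | op : Raw X → Raw X
  | mul : Raw X → Raw X → Raw X

/-- The congruence on expressions generated by associativity and commutativity of the product. -/
inductive Raw.Rel {X : Type*} : Raw X → Raw X → Prop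
  | refl (a : Raw X) : Raw.Rel a a
  | symm {a b : Raw X} : Raw.Rel a b → Raw.Rel b a
  | trans {a b c : Raw X} : Raw.Rel a b → Raw.Rel b c → Raw.Rel a c
  | op {a b : Raw X} : Raw.Rel a b → Raw.Rel (Raw.op a) (Raw.op b)
  | mul {a b c d : Raw X} : Raw.Rel a b → Raw.Rel c d → Raw.Rel (Raw.mul a c) (Raw.mul b d)
  | comm (a b : Raw X) : Raw.Rel (Raw.mul a b) (Raw.mul b a)
  | assoc (a b c : Raw X) :
      Raw.Rel (Raw.mul (Raw.mul a b) c) (Raw.mul a (Raw.mul b c))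

instance Raw.instSetoid (X : Type*) : Setoid (Raw X) where
  r := Raw.Rel
  iseqv := ⟨Raw.Rel.refl, Raw.Rel.symm, Raw.Rel.trans⟩

/-- `𝒬(X)`: the commutative `Ω`-words on `X` for `Ω = {D}`, i.e. the commutative semigroup
(without identity) with unary operator `D` freely generated by the set `X`. -/
def Word (X : Type*) : Type _ := Quotient (Raw.instSetoid X)

namespace Word

variable {X Y : Type*}

/-- A letter of `X`, as a word. -/
def var (x : X) : Word X := Quotient.mk _ (Raw.var x)

/-- The operator `u ↦ D(u)` on words. -/
def op : Word X → Word X :=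
  Quotient.map Raw.op (fun _ _ h => Raw.Rel.op h)

instance instCommSemigroup : CommSemigroup (Word X) where
  mul := Quotient.map₂ Raw.mul (fun _ _ h _ _ h' => Raw.Rel.mul h h')
  mul_assoc a b c := by
    induction a using Quotient.ind
    induction b using Quotient.ind
    induction c using Quotient.ind
    exact Quotient.sound (Raw.Rel.assoc _ _ _)
  mul_comm a b := by
    induction a using Quotient.ind
    induction b using Quotient.ind
    exact Quotient.sound (Raw.Rel.comm _ _)

end Word

/-- Value of an expression in a commutative semigroup with a unary operator. -/
def Raw.eval {X M : Type*} [CommSemigroup M] (d : M → M) (f : X → M) : Raw X → M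
  | Raw.var x => f x
  | Raw.op a => d (Raw.eval d f a)
  | Raw.mul a b => Raw.eval d f a * Raw.eval d f b

theorem Raw.Rel.eval_eq {X M : Type*} [CommSemigroup M] (d : M → M) (f : X → M) {a b : Raw X}
    (h : Raw.Rel a b) : Raw.eval d f a = Raw.eval d f b := by
  induction h with
  | refl => rfl
  | symm _ ih => exact ih.symm
  | trans _ _ ih ih' => exact ih.trans ih'
  | op _ ih => simp only [Raw.eval, ih]
  | mul _ _ ih ih' => simp only [Raw.eval, ih, ih']
  | comm a b => exact mul_comm _ _
  | assoc a b c => exact mul_assoc _ _ _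

/-- Number of letters of an expression, the letter `x` being counted with weight `f x`. -/
def Raw.weight {X : Type*} (f : X → ℕ) : Raw X → ℕ
  | Raw.var x => f x
  | Raw.op a => Raw.weight f a
  | Raw.mul a b => Raw.weight f a + Raw.weight f b

theorem Raw.Rel.weight_eq {X : Type*} (f : X → ℕ) {a b : Raw X} (h : Raw.Rel a b) :
    Raw.weight f a = Raw.weight f b := by
  induction h with
  | refl => rfl
  | symm _ ih => exact ih.symm
  | trans _ _ ih ih' => exact ih.trans ih'
  | op _ ih => exact ih
  | mul _ _ ih ih' => simp only [Raw.weight, ih, ih']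
  | comm a b => exact Nat.add_comm _ _
  | assoc a b c => exact Nat.add_assoc _ _ _

/-- Nesting depth of the operator `D` in an expression. -/
def Raw.dep {X : Type*} : Raw X → ℕ
  | Raw.var _ => 0
  | Raw.op a => Raw.dep a + 1
  | Raw.mul a b => max (Raw.dep a) (Raw.dep b)

theorem Raw.Rel.dep_eq {X : Type*} {a b : Raw X} (h : Raw.Rel a b) : Raw.dep a = Raw.dep b := by
  induction h with
  | refl => rfl
  | symm _ ih => exact ih.symm
  | trans _ _ ih ih' => exact ih.trans ih'
  | op _ ih => simp only [Raw.dep, ih]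
  | mul _ _ ih ih' => simp only [Raw.dep, ih, ih']
  | comm a b => exact max_comm _ _
  | assoc a b c => exact max_assoc _ _ _

/-- The multiset of prime factors (elements of `X ∪ D(𝒬(X))`) of an expression. -/
def Raw.factors {X : Type*} : Raw X → Multiset (Word X)
  | Raw.var x => {Word.var x}
  | Raw.op a => {Word.op (Quotient.mk _ a)}
  | Raw.mul a b => Raw.factors a + Raw.factors b

theorem Raw.Rel.factors_eq {X : Type*} {a b : Raw X} (h : Raw.Rel a b) :
    Raw.factors a = Raw.factors b := by
  induction h with
  | refl => rfl
  | symm _ ih => exact ih.symm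
  | trans _ _ ih ih' => exact ih.trans ih'
  | op h _ => simp only [Raw.factors, Quotient.sound (s := Raw.instSetoid X) h]
  | mul _ _ ih ih' => simp only [Raw.factors, ih, ih']
  | comm a b => exact add_comm _ _
  | assoc a b c => exact add_assoc _ _ _

namespace Word

variable {X Y : Type*}

/-- Substitution of the word `f y` for each letter `y`. -/
def subst (f : Y → Word X) : Word Y → Word X :=
  Quotient.lift (Raw.eval op f) (fun _ _ h => Raw.Rel.eval_eq op f h)

/-- Weighted number of occurrences of letters in a word. -/
def weight (f : X → ℕ) : Word X → ℕ :=
  Quotient.lift (Raw.weight f) (fun _ _ h => Raw.Rel.weight_eq f h)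

/-- `deg(u)`: the number of occurrences of letters `x ∈ X` in `u`. -/
def deg : Word X → ℕ := weight (fun _ => 1)

/-- `dep(u)`: the nesting depth of `D` in `u`, which is the least `n` with `u ∈ 𝒬ₙ`. -/
def dep : Word X → ℕ := Quotient.lift Raw.dep (fun _ _ h => Raw.Rel.dep_eq h)

/-- The factors of the unique expression `u = u₁ u₂ ⋯ uₙ` with every `uᵢ ∈ X ∪ D(𝒬(X))`. -/
def factors : Word X → Multiset (Word X) :=
  Quotient.lift Raw.factors (fun _ _ h => Raw.Rel.factors_eq h)

open Classical in
/-- The exponent of the prime factor `w` in `u`. -/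
noncomputable def expo (w u : Word X) : ℕ := Multiset.count w (factors u)

/-! ### The order on words -/

/-- `u < v` when `(deg u, i₁, …, iₜ) < (deg v, j₁, …, jₜ)` lexicographically, where
`u = w₁^{i₁} ⋯ wₜ^{iₜ}`, `v = w₁^{j₁} ⋯ wₜ^{jₜ}`, and the prime factors are listed in decreasing
order `w₁ > ⋯ > wₜ` with respect to the given relation `r` on prime factors. -/
def lexLt (r : Word X → Word X → Prop) (u v : Word X) : Prop :=
  deg u < deg v ∨
    (deg u = deg v ∧ ∃ w, expo w u < expo w v ∧ ∀ w', r w w' → expo w' u = expo w' v)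

/-- The order on prime factors `X ∪ D(𝒬(X))`: letters of `X` are ordered as in `X`, they are
smaller than all `D(b)`, and `D(a) < D(b)` means that `a` is smaller than `b` for `r`. -/
inductive FactorLt [LT X] (r : Word X → Word X → Prop) : Word X → Word X → Prop
  | var_var {x y : X} : x < y → FactorLt r (var x) (var y)
  | var_op (x : X) (b : Word X) : FactorLt r (var x) (op b)
  | op_op {a b : Word X} : r a b → FactorLt r (op a) (op b)

/-- The order on the words of depth at most `n`, by recursion on `n`. -/
def ltAux [LT X] : ℕ → Word X → Word X → Prop
  | 0 => lexLt (FactorLt (fun _ _ => False))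
  | n + 1 => lexLt (FactorLt (ltAux n))

/-- The order on `𝒬(X)`. -/
def lt [LT X] (u v : Word X) : Prop := ltAux (max (dep u) (dep v)) u v

/-! ### Words with a hole, and the words `CS(D^ω(X))` -/

/-- `u` is a `⋆`-word: a word on `X ∪ {⋆}` (with `⋆ = none`) in which `⋆` occurs exactly once. -/
def IsStar (u : Word (Option X)) : Prop :=
  weight (fun o : Option X => match o with
    | none => 1
    | some _ => 0) u = 1

/-- `u|_w`: replace `⋆` by the word `w` in `u`. -/
def plug (u : Word (Option X)) (w : Word X) : Word X :=
  subst (fun o : Option X => match o with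
    | none => w
    | some x => var x) u

/-- The letter `D^i(x)`. -/
def iter (i : ℕ) (x : X) : Word X := op^[i] (var x)

variable (X) in
/-- `D^ω(X) = {D^i(x) : i ≥ 0, x ∈ X}`. -/
def DOmega : Set (Word X) := {w | ∃ (i : ℕ) (x : X), w = iter i x}

variable (X) in
/-- `CS(D^ω(X))`: the commutative semigroup of all commutative monomials in the `D^i(x)`. -/
def CSDOmega : Subsemigroup (Word X) := Subsemigroup.closure (DOmega X)

theorem iter_mem (i : ℕ) (x : X) : iter i x ∈ CSDOmega X :=
  Subsemigroup.subset_closure ⟨i, x, rfl⟩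

end Word

/-! ### The algebra `K[X;D]`, its ideals and quotients -/

/-- `K[X;D]`: the free `K`-module on `𝒬(X)`, with the bilinear extension of the product of words.
It is a commutative, not necessarily unital, `K`-algebra. -/
abbrev Poly (K X : Type*) [CommRing K] : Type _ := MonoidAlgebra K (Word X)

section Poly

variable {K X : Type*} [CommRing K]

/-- A word as an element of `K[X;D]`. -/
noncomputable def word (K : Type*) {X : Type*} [CommRing K] (w : Word X) : Poly K X :=
  MonoidAlgebra.single w 1

/-- The linear extension of `D` to `K[X;D]`. -/
noncomputable def opD (K X : Type*) [CommRing K] : Poly K X →ₗ[K] Poly K X :=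
  MonoidAlgebra.mapDomainLinearMap K K (Word.op (X := X))

/-- The word `w` is the leading term of `f`: it occurs in `f` and all other words that
occur in `f` are smaller. -/
def IsLeading [LT X] (f : Poly K X) (w : Word X) : Prop :=
  f.coeff w ≠ 0 ∧ ∀ v, f.coeff v ≠ 0 → v ≠ w → Word.lt v w

/-- `Irr(S)`: the words that are not of the form `u|_{s̄}` with `u` a `⋆`-word, `s ∈ S`
and `s̄` the leading term of `s`. -/
def Irr [LT X] (S : Set (Poly K X)) : Set (Word X) :=
  {w | ∀ u : Word (Option X), Word.IsStar u → ∀ s ∈ S, ∀ t, IsLeading s t → w ≠ Word.plug u t}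

/-- Ideals of `K[X;D]` as an algebra with operator: submodules closed under multiplication by
arbitrary elements and under `D`. -/
structure IsOpIdeal (I : Submodule K (Poly K X)) : Prop where
  mul_mem : ∀ a, ∀ b ∈ I, a * b ∈ I
  op_mem : ∀ b ∈ I, opD K X b ∈ I

/-- `Id(S)`: the smallest ideal (closed under `D`) of `K[X;D]` containing `S`. -/
noncomputable def Id (S : Set (Poly K X)) : Submodule K (Poly K X) :=
  sInf {I | IsOpIdeal I ∧ S ⊆ I}

theorem isOpIdeal_Id (S : Set (Poly K X)) : IsOpIdeal (Id S) where
  mul_mem a b hb := by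
    rw [Id, Submodule.mem_sInf] at hb ⊢
    exact fun I hI => hI.1.mul_mem a b (hb I hI)
  op_mem b hb := by
    rw [Id, Submodule.mem_sInf] at hb ⊢
    exact fun I hI => hI.1.op_mem b (hb I hI)

/-- `K[X;D|S] = K[X;D]/Id(S)`. -/
def Quo (S : Set (Poly K X)) : Type _ := Poly K X ⧸ Id S

namespace Quo

variable (S : Set (Poly K X))

noncomputable instance instAddCommGroup : AddCommGroup (Quo S) :=
  inferInstanceAs (AddCommGroup (Poly K X ⧸ Id S))

noncomputable instance instModule : Module K (Quo S) :=
  inferInstanceAs (Module K (Poly K X ⧸ Id S))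

/-- The projection `K[X;D] → K[X;D|S]`. -/
noncomputable def mk : Poly K X →ₗ[K] Quo S := (Id S).mkQ

theorem mk_surjective : Function.Surjective (mk S) := (Id S).mkQ_surjective

theorem mk_eq_iff {a b : Poly K X} : mk S a = mk S b ↔ a - b ∈ Id S :=
  Submodule.Quotient.eq (Id S)

noncomputable instance instMul : Mul (Quo S) where
  mul := Quotient.map₂ (fun a b : Poly K X => a * b) (by
    intro a a' h b b' h'
    have h1 : a - a' ∈ Id S := (mk_eq_iff S).1 (Quotient.sound h)
    have h2 : b - b' ∈ Id S := (mk_eq_iff S).1 (Quotient.sound h')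
    refine Quotient.exact ((mk_eq_iff S).2 ?_)
    have e : a * b - a' * b' = b * (a - a') + a' * (b - b') := by
      rw [mul_sub, mul_sub, mul_comm b a, mul_comm b a']
      abel
    rw [e]
    exact (Id S).add_mem ((isOpIdeal_Id S).mul_mem _ _ h1) ((isOpIdeal_Id S).mul_mem _ _ h2))

theorem mk_mul (a b : Poly K X) : mk S (a * b) = mk S a * mk S b := rfl

noncomputable instance instNonUnitalCommRing : NonUnitalCommRing (Quo S) where
  __ := instAddCommGroup S
  __ := instMul S
  left_distrib a b c := by
    obtain ⟨a, rfl⟩ := mk_surjective S a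
    obtain ⟨b, rfl⟩ := mk_surjective S b
    obtain ⟨c, rfl⟩ := mk_surjective S c
    change mk S a * (mk S b + mk S c) = mk S a * mk S b + mk S a * mk S c
    rw [← map_add, ← mk_mul, ← mk_mul, ← mk_mul, ← map_add, mul_add]
  right_distrib a b c := by
    obtain ⟨a, rfl⟩ := mk_surjective S a
    obtain ⟨b, rfl⟩ := mk_surjective S b
    obtain ⟨c, rfl⟩ := mk_surjective S c
    change (mk S a + mk S b) * mk S c = mk S a * mk S c + mk S b * mk S c
    rw [← map_add, ← mk_mul, ← mk_mul, ← mk_mul, ← map_add, add_mul]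
  zero_mul a := by
    obtain ⟨a, rfl⟩ := mk_surjective S a
    change (0 : Quo S) * mk S a = 0
    rw [← map_zero (mk S), ← mk_mul, zero_mul]
  mul_zero a := by
    obtain ⟨a, rfl⟩ := mk_surjective S a
    change mk S a * (0 : Quo S) = 0
    rw [← map_zero (mk S), ← mk_mul, mul_zero]
  mul_assoc a b c := by
    obtain ⟨a, rfl⟩ := mk_surjective S a
    obtain ⟨b, rfl⟩ := mk_surjective S b
    obtain ⟨c, rfl⟩ := mk_surjective S c
    rw [← mk_mul, ← mk_mul, ← mk_mul, ← mk_mul, mul_assoc]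
  mul_comm a b := by
    obtain ⟨a, rfl⟩ := mk_surjective S a
    obtain ⟨b, rfl⟩ := mk_surjective S b
    rw [← mk_mul, ← mk_mul, mul_comm]

instance instIsScalarTower : IsScalarTower K (Quo S) (Quo S) where
  smul_assoc k a b := by
    obtain ⟨a, rfl⟩ := mk_surjective S a
    obtain ⟨b, rfl⟩ := mk_surjective S b
    change (k • mk S a) * mk S b = k • (mk S a * mk S b)
    rw [← map_smul, ← mk_mul, ← mk_mul, ← map_smul, smul_mul_assoc]

instance instSMulCommClass : SMulCommClass K (Quo S) (Quo S) where
  smul_comm k a b := by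
    obtain ⟨a, rfl⟩ := mk_surjective S a
    obtain ⟨b, rfl⟩ := mk_surjective S b
    change k • (mk S a * mk S b) = mk S a * (k • mk S b)
    rw [← map_smul, ← mk_mul, ← mk_mul, ← map_smul, mul_smul_comm]

/-- The operator on `K[X;D|S]` induced by `D`. -/
noncomputable def opD : Quo S →ₗ[K] Quo S :=
  (Id S).mapQ (Id S) (CommDiff.opD K X) (fun b hb => (isOpIdeal_Id S).op_mem b hb)

theorem opD_mk (a : Poly K X) : opD S (mk S a) = mk S (CommDiff.opD K X a) := rfl

end Quo

end Poly

/-- `d` is a `λ`-differential operator on the commutative (not necessarily unital)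
`K`-algebra `R`, i.e. `(R, d)` is a commutative `λ`-differential algebra. -/
def IsLamDiff {K R : Type*} [CommRing K] [NonUnitalCommRing R] [Module K R]
    (lam : K) (d : R →ₗ[K] R) : Prop :=
  ∀ u v : R, d (u * v) = d u * v + u * d v + lam • (d u * d v)

/-- `S = {D(uv) - D(u)v - uD(v) - λD(u)D(v) : u, v ∈ 𝒬(X)}`. -/
def diffRel {K : Type*} (X : Type*) [CommRing K] (lam : K) : Set (Poly K X) :=
  {s | ∃ u v : Word X, s = word K (Word.op (u * v)) - word K (Word.op u * v)
    - word K (u * Word.op v) - lam • word K (Word.op u * Word.op v)}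

end CommDiff

/-! The relation for `u, v` has leading word `D(uv)`. Its other words are products of the same
degree, and every factor of such a product has strictly smaller degree than the product, because
there is no empty word. Since factors `D(a)` are compared by degree first, `D(uv)` lies above all of
these factors (`mul_lt_op`, `not_op_lt_mul`). So `Irr(S)` consists of the words with no product
below a `D`, and these are the monomials in the `D^i(x)` (`irr_diffRel`).

The basis is obtained directly. Spanning: the span of the monomials contains `X` and is closed under
products and, by the Leibniz rule, under `D` (`top_le_monomialSpan`). Independence: the polynomial
ring in variables `(i, x)` carries a `λ`-derivation with `(i, x) ↦ (i + 1, x)`, because `p ↦ p +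
d(p) ε` with `ε² = λ ε` can be prescribed freely on variables. The induced map from the quotient
sends distinct monomials in the `D^i(x)` to distinct monomials of that ring
(`linearIndependent_mk_word`).

The universal property holds because evaluation in `(R, d)` has a kernel that is an ideal closed
under `D` and contains `S` (`Id_le_ker_polyLift`). -/

namespace CommDiff

namespace Word

variable {X Y : Type*}

/-! ### Structural induction and evaluation of words -/

@[elab_as_elim]
theorem inductionOn {p : Word X → Prop} (w : Word X) (var : ∀ x, p (var x))
    (op : ∀ a, p a → p (op a)) (mul : ∀ a b, p a → p b → p (a * b)) : p w := by
  induction w using Quotient.ind with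
  | _ r =>
    induction r with
    | var x => exact var x
    | op a ih => exact op _ ih
    | mul a b iha ihb => exact mul _ _ iha ihb

/-- The evaluation of words in a commutative semigroup with a unary operator. -/
def evalHom {M : Type*} [CommSemigroup M] (d : M → M) (f : X → M) : Word X →ₙ* M where
  toFun := Quotient.lift (Raw.eval d f) (fun _ _ h => Raw.Rel.eval_eq d f h)
  map_mul' a b := by
    induction a using Quotient.ind
    induction b using Quotient.ind
    rfl

section evalHom

variable {M : Type*} [CommSemigroup M] (d : M → M) (f : X → M)

@[simp] theorem evalHom_var (x : X) : evalHom d f (var x) = f x := rfl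

@[simp] theorem evalHom_op (a : Word X) : evalHom d f (op a) = d (evalHom d f a) := by
  induction a using Quotient.ind
  rfl

theorem evalHom_iter (i : ℕ) (x : X) : evalHom d f (iter i x) = d^[i] (f x) := by
  induction i with
  | zero => rfl
  | succ i ih =>
    rw [iter, Function.iterate_succ_apply', evalHom_op, Function.iterate_succ_apply', ← ih, iter]

end evalHom

theorem subst_mul (f : Y → Word X) (a b : Word Y) :
    subst f (a * b) = subst f a * subst f b :=
  map_mul (evalHom op f) a b

theorem subst_op (f : Y → Word X) (a : Word Y) : subst f (op a) = op (subst f a) :=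
  evalHom_op op f a

@[simp] theorem weight_mul (f : X → ℕ) (a b : Word X) :
    weight f (a * b) = weight f a + weight f b := by
  induction a using Quotient.ind
  induction b using Quotient.ind
  rfl

@[simp] theorem weight_op (f : X → ℕ) (a : Word X) : weight f (op a) = weight f a := by
  induction a using Quotient.ind
  rfl

@[simp] theorem weight_var (f : X → ℕ) (x : X) : weight f (var x) = f x := rfl

@[simp] theorem deg_mul (a b : Word X) : deg (a * b) = deg a + deg b := weight_mul _ a b

@[simp] theorem deg_op (a : Word X) : deg (op a) = deg a := weight_op _ a

theorem deg_pos (a : Word X) : 0 < deg a := by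
  induction a using inductionOn with
  | var x => exact Nat.one_pos
  | op a ih => rwa [deg_op]
  | mul a b iha ihb => rw [deg_mul]; omega

@[simp] theorem dep_op (a : Word X) : dep (op a) = dep a + 1 := by
  induction a using Quotient.ind
  rfl

@[simp] theorem factors_mul (a b : Word X) : factors (a * b) = factors a + factors b := by
  induction a using Quotient.ind
  induction b using Quotient.ind
  rfl

@[simp] theorem factors_op (a : Word X) : factors (op a) = {op a} := by
  induction a using Quotient.ind
  rfl

@[simp] theorem factors_var (x : X) : factors (var x) = {var x} := rfl

theorem card_factors_pos (a : Word X) : 0 < Multiset.card (factors a) := by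
  induction a using inductionOn with
  | var x => simp
  | op a ih => simp
  | mul a b iha ihb => rw [factors_mul, Multiset.card_add]; omega

theorem mem_factors {a w : Word X} (h : w ∈ factors a) :
    ((∃ x, w = var x) ∨ ∃ b, w = op b) ∧ deg w ≤ deg a := by
  induction a using inductionOn with
  | var x =>
    rw [factors_var, Multiset.mem_singleton] at h
    exact ⟨Or.inl ⟨x, h⟩, h ▸ le_rfl⟩
  | op a ih =>
    rw [factors_op, Multiset.mem_singleton] at h
    exact ⟨Or.inr ⟨a, h⟩, h ▸ le_rfl⟩
  | mul a b iha ihb =>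
    rw [factors_mul, Multiset.mem_add] at h
    rw [deg_mul]
    rcases h with h | h
    · exact ⟨(iha h).1, by have := (iha h).2; omega⟩
    · exact ⟨(ihb h).1, by have := (ihb h).2; omega⟩

/-- A left inverse is built on expressions: it fixes letters, strips the outer `D` of each factor
and is multiplicative, so it respects the congruence. -/
theorem op_injective : Function.Injective (op : Word X → Word X) := by
  intro a b h
  let g : Word X → Word X := Quotient.lift
    (fun r : Raw X => Raw.rec (motive := fun _ => Word X) var (fun a _ => Quotient.mk _ a)
      (fun _ _ a b => a * b) r) (by
        intro a b h
        change Raw.Rel a b at h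
        induction h with
        | refl => rfl
        | symm _ ih => exact ih.symm
        | trans _ _ ih ih' => exact ih.trans ih'
        | op h _ => exact Quotient.sound h
        | mul _ _ ih ih' => exact congrArg₂ (· * ·) ih ih'
        | comm a b => exact mul_comm _ _
        | assoc a b c => exact mul_assoc _ _ _)
  have hg : ∀ a, g (op a) = a := fun a => by
    induction a using Quotient.ind
    rfl
  rw [← hg a, h, hg]

theorem var_ne_op (x : X) (a : Word X) : var x ≠ op a := fun h => by
  have := congrArg dep h
  rw [dep_op] at this
  exact absurd this (Nat.succ_ne_zero _).symm

/-! ### The leading word of a Leibniz relation -/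

/-- A factor of `a * b` comes from one side only, and the other side has positive degree. -/
theorem deg_lt_of_mem_factors_mul {a b w : Word X} (h : w ∈ factors (a * b)) :
    deg w < deg (a * b) := by
  have ha := deg_pos a
  have hb := deg_pos b
  rw [factors_mul, Multiset.mem_add] at h
  rw [deg_mul]
  rcases h with h | h
  · have := (mem_factors h).2
    omega
  · have := (mem_factors h).2
    omega

theorem expo_eq_zero {w u : Word X} (h : w ∉ factors u) : expo w u = 0 :=
  by
  classical exact Multiset.count_eq_zero_of_notMem h

theorem op_notMem_factors_mul {a b c : Word X} (hd : deg (a * b) = deg c) :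
    op c ∉ factors (a * b) := fun h => by
  have := deg_lt_of_mem_factors_mul h
  rw [deg_op] at this
  omega

theorem expo_op_self (c : Word X) : expo (op c) (op c) = 1 := by
  rw [expo, factors_op]
  classical exact Multiset.count_singleton_self _

theorem op_ne_mul {a b c : Word X} : op c ≠ a * b := fun h => by
  have := congrArg (Multiset.card ∘ factors) h
  have ha := card_factors_pos a
  have hb := card_factors_pos b
  simp only [Function.comp_apply, factors_op, factors_mul, Multiset.card_add,
    Multiset.card_singleton] at this
  omega

section Order

variable [LT X]

theorem ltAux_of_deg_lt (n : ℕ) {a b : Word X} (h : deg a < deg b) : ltAux n a b := by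
  cases n <;> exact Or.inl h

theorem deg_le_of_ltAux {n : ℕ} {a b : Word X} (h : ltAux n a b) : deg a ≤ deg b := by
  cases n <;> exact h.elim le_of_lt fun h => h.1.le

theorem not_ltAux_self (n : ℕ) (a : Word X) : ¬ ltAux n a a := by
  cases n <;>
  · rintro (h | ⟨-, w, h, -⟩)
    · exact lt_irrefl _ h
    · exact lt_irrefl _ h

theorem factorLt_op_of_mem_factors_mul (n : ℕ) {a b c w : Word X}
    (hd : deg (a * b) = deg c) (h : w ∈ factors (a * b)) : FactorLt (ltAux n) w (op c) := by
  have hw := deg_lt_of_mem_factors_mul h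
  rcases (mem_factors h).1 with ⟨x, rfl⟩ | ⟨e, rfl⟩
  · exact .var_op x c
  · refine .op_op (ltAux_of_deg_lt n ?_)
    rwa [deg_op, hd] at hw

/-- Only `op_op` can put something above `op c`, and then the degree does not drop and irreflexivity
excludes equality. -/
theorem not_factorLt_op {n : ℕ} {c w : Word X} (h : FactorLt (ltAux n) (op c) w)
    (hw : deg w < deg c ∨ w = op c) : False := by
  -- `op c` is not a constructor term, so the index must become a variable before case analysis.
  generalize hv : op c = v at h
  cases h with
  | var_var _ => exact var_ne_op _ _ hv.symm
  | var_op _ _ => exact var_ne_op _ _ hv.symm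
  | @op_op a b h =>
    obtain rfl := op_injective hv
    rcases hw with hw | hw
    · have := deg_le_of_ltAux h
      rw [deg_op] at hw
      omega
    · rw [op_injective hw] at h
      exact not_ltAux_self n _ h

theorem mul_lt_op {a b c : Word X} (hd : deg (a * b) = deg c) : lt (a * b) (op c) := by
  -- `op c` has positive depth, so the order unfolds to the successor case, where factors are
  -- compared by `ltAux n`.
  obtain ⟨n, hn⟩ : ∃ n, max (dep (a * b)) (dep (op c)) = n + 1 :=
    Nat.exists_eq_succ_of_ne_zero (by rw [dep_op]; omega)
  rw [lt, hn]
  -- The deciding factor is `op c`, with exponents 0 and 1; no factor above it occurs in either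
  -- word.
  refine Or.inr ⟨by rw [hd, deg_op], op c, ?_, fun w' hw' => ?_⟩
  · rw [expo_eq_zero (op_notMem_factors_mul hd), expo_op_self]
    exact Nat.one_pos
  · rw [expo_eq_zero, expo_eq_zero]
    · rw [factors_op, Multiset.mem_singleton]
      exact fun h => not_factorLt_op hw' (Or.inr h)
    · exact fun h => not_factorLt_op hw' (Or.inl (hd ▸ deg_lt_of_mem_factors_mul h))

/-- Needed for uniqueness of the leading word. A factor deciding the comparison would occur in `a *
b`, hence lie below `op c`, and the exponents 1 and 0 of `op c` would have to agree. -/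
theorem not_op_lt_mul {a b c : Word X} (hd : deg (a * b) = deg c) : ¬ lt (op c) (a * b) := by
  obtain ⟨n, hn⟩ : ∃ n, max (dep (op c)) (dep (a * b)) = n + 1 :=
    Nat.exists_eq_succ_of_ne_zero (by rw [dep_op]; omega)
  rw [lt, hn]
  rintro (h | ⟨-, w, hw, h⟩)
  · rw [hd, deg_op] at h
    exact lt_irrefl _ h
  · have hmem : w ∈ factors (a * b) := by
      by_contra hc
      rw [expo_eq_zero hc] at hw
      omega
    have := h _ (factorLt_op_of_mem_factors_mul n hd hmem)
    rw [expo_eq_zero (op_notMem_factors_mul hd), expo_op_self] at this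
    exact one_ne_zero this

end Order

/-! ### Reducible words -/

/-- The image of a word in the words with an additional letter `⋆`. -/
def embed (w : Word X) : Word (Option X) := subst (fun x => var (some x)) w

theorem plug_mul (u v : Word (Option X)) (w : Word X) :
    plug (u * v) w = plug u w * plug v w := subst_mul _ u v

theorem plug_op (u : Word (Option X)) (w : Word X) : plug (op u) w = op (plug u w) :=
  subst_op _ u

theorem plug_embed (v w : Word X) : plug (embed v) w = v := by
  induction v using inductionOn with
  | var x => rfl
  | op a ih => rw [embed, subst_op, plug_op]; exact congrArg op ih
  | mul a b iha ihb => rw [embed, subst_mul, plug_mul]; exact congrArg₂ (· * ·) iha ihb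

theorem IsStar.op {u : Word (Option X)} (h : IsStar u) : IsStar (Word.op u) :=
  (weight_op _ u).trans h

theorem IsStar.mul_embed {u : Word (Option X)} (h : IsStar u) (v : Word X) :
    IsStar (u * embed v) := by
  refine (weight_mul _ u _).trans ?_
  rw [show weight _ u = 1 from h, Nat.add_eq_left]
  induction v using inductionOn with
  | var x => rfl
  | op a ih => rw [embed, subst_op, weight_op]; exact ih
  | mul a b iha ihb => rw [embed, subst_mul, weight_mul]; exact Nat.add_eq_zero_iff.2 ⟨iha, ihb⟩

theorem op_mem_DOmega {w : Word X} (h : w ∈ DOmega X) : op w ∈ DOmega X := by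
  obtain ⟨i, x, rfl⟩ := h
  exact ⟨i + 1, x, (Function.iterate_succ_apply' op i (var x)).symm⟩

theorem mem_DOmega_or_eq_mul (w : Word X) (h : w ∈ CSDOmega X) :
    w ∈ DOmega X ∨ ∃ a b, w = a * b := by
  induction h using Subsemigroup.closure_induction with
  | mem w h => exact Or.inl h
  | mul a b _ _ _ _ => exact Or.inr ⟨a, b, rfl⟩

/-- Structural induction: a subword `D(ab)` already found survives in any larger word. A new one can
appear only when `D` is applied to a monomial, which is either a single `D^i(x)` or a product. -/
theorem mem_CSDOmega_or_eq_plug (w : Word X) :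
    w ∈ CSDOmega X ∨ ∃ u, IsStar u ∧ ∃ a b, w = plug u (op (a * b)) := by
  induction w using inductionOn with
  | var x => exact Or.inl (iter_mem 0 x)
  | op w ih =>
    rcases ih with h | ⟨u, hu, a, b, rfl⟩
    · rcases mem_DOmega_or_eq_mul w h with h | ⟨a, b, rfl⟩
      · exact Or.inl (Subsemigroup.subset_closure (op_mem_DOmega h))
      -- The whole word is `D(ab)`, so the context is `⋆` itself.
      · exact Or.inr ⟨var none, rfl, a, b, rfl⟩
    · exact Or.inr ⟨op u, hu.op, a, b, (plug_op u _).symm⟩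
  | mul v w ihv ihw =>
    rcases ihv with hv | ⟨u, hu, a, b, rfl⟩
    · rcases ihw with hw | ⟨u, hu, a, b, rfl⟩
      · exact Or.inl (mul_mem hv hw)
      · exact Or.inr ⟨u * embed v, hu.mul_embed v, a, b, by rw [plug_mul, plug_embed, mul_comm]⟩
    · exact Or.inr ⟨u * embed w, hu.mul_embed w, a, b, by rw [plug_mul, plug_embed]⟩

end Word

/-- No product occurs below the operator. -/
def Raw.IsDiffMonomial {X : Type*} : Raw X → Prop
  | Raw.var _ => True
  | Raw.op a => Raw.IsDiffMonomial a ∧ Multiset.card (Raw.factors a) = 1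
  | Raw.mul a b => Raw.IsDiffMonomial a ∧ Raw.IsDiffMonomial b

theorem Raw.Rel.isDiffMonomial_eq {X : Type*} {a b : Raw X} (h : Raw.Rel a b) :
    Raw.IsDiffMonomial a = Raw.IsDiffMonomial b := by
  induction h with
  | refl => rfl
  | symm _ ih => exact ih.symm
  | trans _ _ ih ih' => exact ih.trans ih'
  | op h ih => simp only [Raw.IsDiffMonomial, ih, h.factors_eq]
  | mul _ _ ih ih' => simp only [Raw.IsDiffMonomial, ih, ih']
  | comm a b => exact propext and_comm
  | assoc a b c => exact propext and_assoc

namespace Word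

variable {X : Type*}

/-- No product occurs below the operator. -/
def IsDiffMonomial : Word X → Prop :=
  Quotient.lift Raw.IsDiffMonomial (fun _ _ h => Raw.Rel.isDiffMonomial_eq h)

theorem isDiffMonomial_mul {a b : Word X} :
    IsDiffMonomial (a * b) ↔ IsDiffMonomial a ∧ IsDiffMonomial b := by
  induction a using Quotient.ind
  induction b using Quotient.ind
  rfl

theorem isDiffMonomial_op {a : Word X} :
    IsDiffMonomial (op a) ↔ IsDiffMonomial a ∧ Multiset.card (factors a) = 1 := by
  induction a using Quotient.ind
  rfl

theorem isDiffMonomial_iter (i : ℕ) (x : X) :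
    IsDiffMonomial (iter i x) ∧ Multiset.card (factors (iter i x)) = 1 := by
  induction i with
  | zero => exact ⟨trivial, rfl⟩
  | succ i ih =>
    rw [iter, Function.iterate_succ_apply', factors_op, isDiffMonomial_op]
    exact ⟨ih, rfl⟩

theorem isDiffMonomial_of_mem {w : Word X} (h : w ∈ CSDOmega X) : IsDiffMonomial w := by
  induction h using Subsemigroup.closure_induction with
  | mem w h =>
    obtain ⟨i, x, rfl⟩ := h
    exact (isDiffMonomial_iter i x).1
  | mul a b _ _ iha ihb => exact isDiffMonomial_mul.2 ⟨iha, ihb⟩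

theorem not_isDiffMonomial_op_mul (a b : Word X) : ¬ IsDiffMonomial (op (a * b)) := fun h => by
  have := (isDiffMonomial_op.1 h).2
  have ha := card_factors_pos a
  have hb := card_factors_pos b
  rw [factors_mul, Multiset.card_add] at this
  omega

/-- The weight of `⋆` is assumed nonzero rather than 1 so that the induction passes through
products: a nonzero sum has a nonzero summand. -/
theorem isDiffMonomial_of_plug {u : Word (Option X)} {w : Word X}
    (hu : weight (fun o : Option X => match o with
      | none => 1
      | some _ => 0) u ≠ 0) (h : IsDiffMonomial (plug u w)) : IsDiffMonomial w := by
  induction u using inductionOn with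
  | var o =>
    cases o with
    | none => exact h
    | some x => exact absurd rfl hu
  | op a ih =>
    rw [weight_op] at hu
    rw [plug_op, isDiffMonomial_op] at h
    exact ih hu h.1
  | mul a b iha ihb =>
    rw [plug_mul, isDiffMonomial_mul] at h
    rw [weight_mul] at hu
    by_cases ha : weight (fun o : Option X => match o with
      | none => 1
      | some _ => 0) a = 0
    · exact ihb (fun hb => hu (by rw [ha, hb])) h.2
    · exact iha ha h.1

end Word

/-! ### Leading words of the relations and `Irr(S)` -/

section Irr

variable {K X : Type*} [CommRing K]

open Word

/-- The Leibniz relation `D(uv) - D(u)v - uD(v) - λD(u)D(v)`. -/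
noncomputable def leibniz (lam : K) (u v : Word X) : Poly K X :=
  word K (op (u * v)) - word K (op u * v) - word K (u * op v) - lam • word K (op u * op v)

theorem coeff_word_self (w : Word X) : (word K w).coeff w = 1 := by
  rw [word, MonoidAlgebra.coeff_single, Finsupp.single_eq_same]

theorem coeff_word_of_ne {v w : Word X} (h : v ≠ w) : (word K v).coeff w = 0 := by
  rw [word, MonoidAlgebra.coeff_single, Finsupp.single_eq_of_ne h.symm]

theorem coeff_leibniz_op (lam : K) (u v : Word X) :
    (leibniz lam u v).coeff (op (u * v)) = 1 := by
  simp only [leibniz, MonoidAlgebra.coeff_sub, MonoidAlgebra.coeff_smul, Finsupp.sub_apply,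
    Finsupp.smul_apply, coeff_word_self, coeff_word_of_ne op_ne_mul.symm]
  simp

/-- Only one implication is available: the three product words can coincide, as `D(u)v = uD(v)` for
`u = v`, and their coefficients can vanish, as for `λ = 0`. -/
theorem eq_mul_of_coeff_leibniz {lam : K} {u v w : Word X}
    (h : (leibniz lam u v).coeff w ≠ 0) (hw : w ≠ op (u * v)) :
    ∃ a b, w = a * b ∧ deg (a * b) = deg (u * v) := by
  by_cases h1 : op u * v = w
  · exact ⟨_, _, h1.symm, by simp⟩
  by_cases h2 : u * op v = w
  · exact ⟨_, _, h2.symm, by simp⟩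
  by_cases h3 : op u * op v = w
  · exact ⟨_, _, h3.symm, by simp⟩
  refine absurd ?_ h
  simp only [leibniz, MonoidAlgebra.coeff_sub, MonoidAlgebra.coeff_smul, Finsupp.sub_apply,
    Finsupp.smul_apply, coeff_word_of_ne hw.symm, coeff_word_of_ne h1, coeff_word_of_ne h2,
    coeff_word_of_ne h3]
  simp

variable [LT X]

theorem isLeading_leibniz_iff [Nontrivial K] {lam : K} {u v t : Word X} :
    IsLeading (leibniz lam u v) t ↔ t = op (u * v) := by
  constructor
  · rintro ⟨ht, h⟩
    by_contra hne
    obtain ⟨a, b, rfl, hd⟩ := eq_mul_of_coeff_leibniz ht hne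
    refine not_op_lt_mul hd (h _ ?_ (Ne.symm hne))
    rw [coeff_leibniz_op]
    exact one_ne_zero
  · rintro rfl
    refine ⟨by rw [coeff_leibniz_op]; exact one_ne_zero, fun w hw hne => ?_⟩
    obtain ⟨a, b, rfl, hd⟩ := eq_mul_of_coeff_leibniz hw hne
    exact mul_lt_op hd

/-- A word outside `CSDOmega X` contains some `D(ab)`. Conversely, `IsDiffMonomial` holds on
`CSDOmega X`, passes to the plugged-in word and fails for `D(ab)`. -/
theorem irr_diffRel [Nontrivial K] (lam : K) :
    Irr (diffRel X lam) = (CSDOmega X : Set (Word X)) := by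
  ext w
  constructor
  · intro h
    refine (mem_CSDOmega_or_eq_plug w).resolve_right ?_
    rintro ⟨u, hu, a, b, hw⟩
    exact h u hu _ ⟨a, b, rfl⟩ _ (isLeading_leibniz_iff.2 rfl) hw
  · rintro hw u hu _ ⟨a, b, rfl⟩ t ht rfl
    obtain rfl := isLeading_leibniz_iff.1 ht
    exact not_isDiffMonomial_op_mul a b
      (isDiffMonomial_of_plug (ne_of_eq_of_ne hu one_ne_zero) (isDiffMonomial_of_mem hw))

end Irr

end CommDiff

namespace CommDiff

namespace Word

variable {X : Type*}

/-! ### Freeness of the semigroup of monomials in the `D^i(x)` -/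

/-- The multiset of indices `(i, x)` of the letters `D^i(x)` occurring in a monomial. -/
def letters : Word X →ₙ* Multiplicative (Multiset (ℕ × X)) :=
  evalHom (fun s => .ofAdd (s.toAdd.map (Prod.map Nat.succ id)))
    (fun x => .ofAdd {(0, x)})

theorem letters_iter (i : ℕ) (x : X) : letters (iter i x) = .ofAdd {(i, x)} := by
  rw [letters, evalHom_iter]
  induction i with
  | zero => rfl
  | succ i ih =>
    rw [Function.iterate_succ_apply', ih]
    rfl

/-- The product of the values `f i x` over the letters of a monomial. -/
def lettersProd {M : Type*} [CommMonoid M] (f : ℕ → X → M) : Word X →ₙ* M where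
  toFun w := ((letters w).toAdd.map fun p => f p.1 p.2).prod
  map_mul' a b := by rw [map_mul, toAdd_mul, Multiset.map_add, Multiset.prod_add]

theorem lettersProd_iter {M : Type*} [CommMonoid M] (f : ℕ → X → M) (i : ℕ) (x : X) :
    lettersProd f (iter i x) = f i x := by
  simp [lettersProd, letters_iter]

/-- Multiset products need a unit, which `G` may lack. The product is taken in `WithOne G`, and
nonempty monomials never reach the adjoined unit. -/
theorem exists_coe_eq_lettersProd {G : Type*} [CommSemigroup G] (f : ℕ → X → G)
    {w : Word X} (hw : w ∈ CSDOmega X) :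
    ∃ g : G, (g : WithOne G) = lettersProd (fun i x => (f i x : WithOne G)) w := by
  induction hw using Subsemigroup.closure_induction with
  | mem w h =>
    obtain ⟨i, x, rfl⟩ := h
    exact ⟨f i x, (lettersProd_iter (fun i x => (f i x : WithOne G)) i x).symm⟩
  | mul a b _ _ iha ihb =>
    obtain ⟨g, hg⟩ := iha
    obtain ⟨h, hh⟩ := ihb
    exact ⟨g * h, by rw [map_mul, ← hg, ← hh, WithOne.coe_mul]⟩

theorem mulHom_ext {G : Type*} [CommSemigroup G] {φ ψ : CSDOmega X →ₙ* G}
    (h : ∀ i x, φ ⟨iter i x, iter_mem i x⟩ = ψ ⟨iter i x, iter_mem i x⟩) : φ = ψ := by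
  ext ⟨w, hw⟩
  induction hw using Subsemigroup.closure_induction with
  | mem w h' =>
    obtain ⟨i, x, rfl⟩ := h'
    exact h i x
  | mul a b ha hb iha ihb =>
    change φ (⟨a, ha⟩ * ⟨b, hb⟩) = ψ (⟨a, ha⟩ * ⟨b, hb⟩)
    rw [map_mul, map_mul, iha, ihb]

/-- The last clause records that `φ w` depends only on `letters w`; this is what gives injectivity
of `letters`. -/
theorem exists_mulHom {G : Type*} [CommSemigroup G] (f : ℕ → X → G) :
    ∃ φ : CSDOmega X →ₙ* G, (∀ i x, φ ⟨iter i x, iter_mem i x⟩ = f i x) ∧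
      ∀ w : CSDOmega X,
        (φ w : WithOne G) = lettersProd (fun i x => (f i x : WithOne G)) (w : Word X) := by
  choose g hg using fun w : CSDOmega X => exists_coe_eq_lettersProd f w.2
  refine ⟨⟨g, fun a b => WithOne.coe_injective ?_⟩, fun i x => WithOne.coe_injective ?_, hg⟩
  · rw [hg, WithOne.coe_mul, hg, hg, ← map_mul]
    rfl
  · exact (hg _).trans (lettersProd_iter (fun i x => (f i x : WithOne G)) i x)

theorem existsUnique_mulHom {G : Type*} [CommSemigroup G] (f : ℕ → X → G) :
    ∃! φ : CSDOmega X →ₙ* G, ∀ i x, φ ⟨iter i x, iter_mem i x⟩ = f i x := by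
  obtain ⟨φ, hφ, -⟩ := exists_mulHom f
  exact ⟨φ, hφ, fun ψ hψ => mulHom_ext fun i x => (hψ i x).trans (hφ i x).symm⟩

/-- With `G` the monomial semigroup itself and each letter sent to itself, the extension is the
identity, yet it factors through `letters`. -/
theorem letters_injective :
    Function.Injective fun w : CSDOmega X => letters (w : Word X) := by
  intro v w h
  obtain ⟨φ, hφ, hφ'⟩ :=
    exists_mulHom (G := CSDOmega X) fun (i : ℕ) (x : X) => ⟨iter i x, iter_mem i x⟩
  have hid : φ = MulHom.id _ := mulHom_ext hφ
  have hvw : φ v = φ w := WithOne.coe_injective <| by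
    rw [hφ', hφ']
    exact congrArg (fun s : Multiplicative (Multiset (ℕ × X)) => (s.toAdd.map fun p =>
      ((⟨iter p.1 p.2, iter_mem p.1 p.2⟩ : CSDOmega X) : WithOne (CSDOmega X))).prod) h
  rwa [hid] at hvw

end Word

open Word

variable {K X : Type*} [CommRing K]

/-! ### The quotient as a `λ`-differential algebra -/

theorem word_mul (u v : Word X) : word K (u * v) = word K u * word K v := by
  rw [word, word, word, MonoidAlgebra.single_mul_single, mul_one]

theorem opD_word (u : Word X) : opD K X (word K u) = word K (op u) :=
  MonoidAlgebra.mapDomainLinearMap_single _ _ _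

/-- A linear property of elements of `K[X;D]` follows from the case of words. -/
theorem poly_induction {p : Poly K X → Prop} (a : Poly K X) (zero : p 0)
    (add : ∀ a b, p a → p b → p (a + b)) (smul : ∀ (k : K) a, p a → p (k • a))
    (word : ∀ w, p (word K w)) : p a := by
  induction a using MonoidAlgebra.induction_linear with
  | zero => exact zero
  | add a b ha hb => exact add a b ha hb
  | single w k =>
    have := smul k _ (word w)
    rwa [CommDiff.word, MonoidAlgebra.smul_single, smul_eq_mul, mul_one] at this

theorem subset_Id (S : Set (Poly K X)) : S ⊆ Id S := fun s hs => by
  rw [Id, SetLike.mem_coe, Submodule.mem_sInf]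
  exact fun I hI => hI.2 hs

theorem Id_le {S : Set (Poly K X)} {I : Submodule K (Poly K X)} (hI : IsOpIdeal I)
    (h : S ⊆ I) : Id S ≤ I := sInf_le ⟨hI, h⟩

variable (lam : K)

theorem Quo.leibniz_word (u v : Word X) :
    mk (diffRel X lam) (word K (op (u * v))) =
      mk _ (word K (op u)) * mk _ (word K v) + mk _ (word K u) * mk _ (word K (op v)) +
        lam • (mk _ (word K (op u)) * mk _ (word K (op v))) := by
  rw [← mk_mul, ← mk_mul, ← mk_mul, ← word_mul, ← word_mul, ← word_mul, ← map_smul, ← map_add,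
    ← map_add, mk_eq_iff, ← sub_sub, ← sub_sub]
  exact subset_Id _ ⟨u, v, rfl⟩

theorem isLamDiff_opD : IsLamDiff lam (Quo.opD (diffRel X lam)) := by
  intro u v
  obtain ⟨a, rfl⟩ := Quo.mk_surjective _ u
  obtain ⟨b, rfl⟩ := Quo.mk_surjective _ v
  induction a using poly_induction with
  | zero => simp
  | add a a' h h' =>
    rw [map_add, add_mul, map_add, h, h', map_add, add_mul, add_mul, add_mul, smul_add]
    abel
  | smul k a h =>
    simp only [map_smul, smul_mul_assoc, h, smul_add]
    rw [smul_comm k lam]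
  | word u =>
    induction b using poly_induction with
    | zero => simp
    | add b b' h h' =>
      rw [map_add, mul_add, map_add, h, h', map_add, mul_add, mul_add, mul_add, smul_add]
      abel
    | smul k b h =>
      simp only [map_smul, mul_smul_comm, h, smul_add]
      rw [smul_comm k lam]
    | word v =>
      rw [← Quo.mk_mul, ← word_mul, Quo.opD_mk, Quo.opD_mk, Quo.opD_mk, opD_word, opD_word,
        opD_word]
      exact Quo.leibniz_word lam u v

/-! ### The universal property of the quotient -/

section lift

variable {R : Type*} [NonUnitalCommRing R] [Module K R] [IsScalarTower K R R]
  [SMulCommClass K R R] (d : R →ₗ[K] R) (φ : X → R)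

/-- The homomorphism of algebras with operator from `K[X;D]` that extends `φ`. -/
noncomputable def polyLift : Poly K X →ₙₐ[K] R := MonoidAlgebra.liftMagma K (evalHom d φ)

@[simp] theorem polyLift_word (w : Word X) : polyLift d φ (word K w) = evalHom d φ w := by
  rw [polyLift, word]
  simp

theorem polyLift_opD (a : Poly K X) : polyLift d φ (opD K X a) = d (polyLift d φ a) := by
  induction a using poly_induction with
  | zero => simp
  | add a b ha hb => simp only [map_add, ha, hb]
  | smul k a ha => simp only [map_smul, ha]
  | word w => rw [opD_word, polyLift_word, polyLift_word, evalHom_op]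

variable {lam d}

/-- By minimality of `Id`: the kernel is an ideal closed under `D`, and it contains the relations
because `d` satisfies the Leibniz rule. -/
theorem Id_le_ker_polyLift (hd : IsLamDiff lam d) :
    Id (diffRel X lam) ≤ LinearMap.ker (polyLift d φ : Poly K X →ₗ[K] R) := by
  have hmem : ∀ a, a ∈ LinearMap.ker (polyLift d φ : Poly K X →ₗ[K] R) ↔ polyLift d φ a = 0 :=
    fun a => LinearMap.mem_ker
  refine Id_le ⟨fun a b hb => ?_, fun b hb => ?_⟩ ?_
  · rw [hmem] at hb ⊢
    rw [map_mul, hb, mul_zero]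
  · rw [hmem] at hb ⊢
    rw [polyLift_opD, hb, map_zero]
  · rintro _ ⟨u, v, rfl⟩
    rw [SetLike.mem_coe, hmem]
    simp only [map_sub, map_smul, polyLift_word, evalHom_op, map_mul]
    rw [hd]
    abel

/-- The homomorphism of `λ`-differential algebras from `K[X;D|S]` that extends `φ`. -/
noncomputable def quoLift (hd : IsLamDiff lam d) : Quo (diffRel X lam) →ₙₐ[K] R where
  toFun := (Id (diffRel X lam)).liftQ _ (Id_le_ker_polyLift φ hd)
  map_smul' k a := map_smul ((Id (diffRel X lam)).liftQ _ (Id_le_ker_polyLift φ hd)) k a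
  map_zero' := map_zero ((Id (diffRel X lam)).liftQ _ (Id_le_ker_polyLift φ hd))
  map_add' a b := map_add ((Id (diffRel X lam)).liftQ _ (Id_le_ker_polyLift φ hd)) a b
  map_mul' a b := by
    obtain ⟨a, rfl⟩ := Quo.mk_surjective _ a
    obtain ⟨b, rfl⟩ := Quo.mk_surjective _ b
    exact map_mul (polyLift d φ) a b

theorem quoLift_mk (hd : IsLamDiff lam d) (a : Poly K X) :
    quoLift φ hd (Quo.mk _ a) = polyLift d φ a := rfl

theorem existsUnique_quo_hom (hd : IsLamDiff lam d) :
    ∃! f : Quo (diffRel X lam) →ₙₐ[K] R,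
      (∀ a, f (Quo.opD (diffRel X lam) a) = d (f a)) ∧
      ∀ x, f (Quo.mk (diffRel X lam) (word K (Word.var x))) = φ x := by
  refine ⟨quoLift φ hd, ⟨fun a => ?_, fun x => ?_⟩, ?_⟩
  · obtain ⟨a, rfl⟩ := Quo.mk_surjective _ a
    rw [Quo.opD_mk, quoLift_mk, quoLift_mk, polyLift_opD]
  · rw [quoLift_mk, polyLift_word, evalHom_var]
  · rintro f ⟨hf, hfx⟩
    ext a
    obtain ⟨a, rfl⟩ := Quo.mk_surjective _ a
    rw [quoLift_mk]
    induction a using poly_induction with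
    | zero => simp
    | add a b ha hb => simp only [map_add, ha, hb]
    | smul k a ha => simp only [map_smul, ha]
    | word w =>
      rw [polyLift_word]
      induction w using Word.inductionOn with
      | var x => exact hfx x
      | op w ih => rw [← opD_word, ← Quo.opD_mk, hf, ih, evalHom_op]
      | mul v w ihv ihw => rw [word_mul, Quo.mk_mul, map_mul, ihv, ihw, map_mul]

end lift

/-! ### The `λ`-derivation of the polynomial ring in the letters `D^i(x)` -/

section MvPolynomial

open MvPolynomial

/-- The homomorphism `p ↦ p + d(p) ε`, where `ε² = λ ε`. -/
noncomputable def diffHom :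
    MvPolynomial (ℕ × X) K →ₐ[K] QuadraticAlgebra (MvPolynomial (ℕ × X) K) 0 (C lam) :=
  aeval fun p => ⟨MvPolynomial.X p, MvPolynomial.X (p.1 + 1, p.2)⟩

theorem re_diffHom (p : MvPolynomial (ℕ × X) K) : (diffHom lam p).re = p := by
  induction p using MvPolynomial.induction_on with
  | C k => exact congrArg QuadraticAlgebra.re ((diffHom lam).commutes k)
  | add p q hp hq => rw [map_add, QuadraticAlgebra.re_add, hp, hq]
  | mul_X p i hp => rw [map_mul, QuadraticAlgebra.re_mul, hp, diffHom, aeval_X]; simp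

/-- The `λ`-derivation with `D^i(x) ↦ D^{i+1}(x)`. -/
noncomputable def mvDiff : MvPolynomial (ℕ × X) K →ₗ[K] MvPolynomial (ℕ × X) K where
  toFun p := (diffHom lam p).im
  map_add' p q := by rw [map_add, QuadraticAlgebra.im_add]
  map_smul' k p := by rw [map_smul, QuadraticAlgebra.im_smul, RingHom.id_apply]

/-- Compare the coefficients of `ε` in `(p + d(p) ε)(q + d(q) ε)`: the term `d(p) d(q) ε²`
contributes `λ d(p) d(q)`. -/
theorem isLamDiff_mvDiff : IsLamDiff lam (mvDiff (X := X) lam) := by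
  intro p q
  change (diffHom lam (p * q)).im = _
  rw [map_mul, QuadraticAlgebra.im_mul, re_diffHom, re_diffHom, smul_eq_C_mul]
  change p * mvDiff lam q + mvDiff lam p * q + C lam * mvDiff lam p * mvDiff lam q = _
  ring

theorem mvDiff_X (i : ℕ) (x : X) :
    mvDiff lam (MvPolynomial.X (i, x) : MvPolynomial (ℕ × X) K) = MvPolynomial.X (i + 1, x) := by
  change (diffHom lam (MvPolynomial.X (i, x))).im = _
  rw [diffHom, aeval_X]

-- Restricted to `CSDOmega X` because below a `D` a product expands by Leibniz into a sum, whereas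
-- `letters` only shifts every index.
open Classical in
theorem evalHom_mvDiff {w : Word X} (hw : w ∈ CSDOmega X) :
    evalHom (mvDiff lam) (fun x => MvPolynomial.X (0, x)) w =
      monomial (Multiset.toFinsupp (letters w).toAdd) (1 : K) := by
  induction hw using Subsemigroup.closure_induction with
  | mem w h =>
    obtain ⟨i, x, rfl⟩ := h
    rw [letters_iter, evalHom_iter, toAdd_ofAdd, Multiset.toFinsupp_singleton]
    change _ = MvPolynomial.X (i, x)
    induction i with
    | zero => rfl
    | succ i ih => rw [Function.iterate_succ_apply', ih, mvDiff_X]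
  | mul a b _ _ iha ihb =>
    rw [map_mul, map_mul, iha, ihb, monomial_mul, toAdd_mul, map_add, one_mul]

end MvPolynomial

/-! ### The basis of the quotient -/

theorem linearIndependent_mk_word :
    LinearIndependent K fun w : CSDOmega X => Quo.mk (diffRel X lam) (word K (w : Word X)) := by
  classical
  let F : Quo (diffRel X lam) →ₗ[K] MvPolynomial (ℕ × X) K :=
    (quoLift (fun x => MvPolynomial.X (0, x)) (isLamDiff_mvDiff lam) :
      Quo (diffRel X lam) →ₙₐ[K] MvPolynomial (ℕ × X) K)
  refine LinearIndependent.of_comp F ?_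
  -- Distinct monomials have distinct exponent vectors, so their images are distinct members of the
  -- monomial basis.
  have hinj : Function.Injective fun w : CSDOmega X =>
      Multiset.toFinsupp (letters (w : Word X)).toAdd := fun v w h =>
    letters_injective (Multiplicative.toAdd.injective (Multiset.toFinsupp.injective h))
  have hF : (F ∘ fun w : CSDOmega X => Quo.mk (diffRel X lam) (word K (w : Word X))) =
      MvPolynomial.basisMonomials (ℕ × X) K ∘
        fun w : CSDOmega X => Multiset.toFinsupp (letters (w : Word X)).toAdd := by
    ext1 w
    rw [Function.comp_apply, Function.comp_apply, MvPolynomial.coe_basisMonomials]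
    exact ((quoLift_mk _ (isLamDiff_mvDiff lam) _).trans (polyLift_word _ _ _)).trans
      (evalHom_mvDiff lam w.2)
  rw [hF]
  exact (MvPolynomial.basisMonomials (ℕ × X) K).linearIndependent.comp _ hinj

/-- The span of the monomials in the `D^i(x)`. -/
noncomputable def monomialSpan (X : Type*) (lam : K) : Submodule K (Quo (diffRel X lam)) :=
  Submodule.span K (Set.range fun w : CSDOmega X => Quo.mk (diffRel X lam) (word K (w : Word X)))

variable {lam}

theorem mk_word_mem_monomialSpan {w : Word X} (hw : w ∈ CSDOmega X) :
    Quo.mk (diffRel X lam) (word K w) ∈ monomialSpan X lam :=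
  Submodule.subset_span ⟨⟨w, hw⟩, rfl⟩

theorem mul_mem_monomialSpan {a b : Quo (diffRel X lam)} (ha : a ∈ monomialSpan X lam)
    (hb : b ∈ monomialSpan X lam) : a * b ∈ monomialSpan X lam := by
  induction ha, hb using Submodule.span_induction₂ with
  | mem_mem a b ha hb =>
    obtain ⟨v, rfl⟩ := ha
    obtain ⟨w, rfl⟩ := hb
    rw [← Quo.mk_mul, ← word_mul]
    exact mk_word_mem_monomialSpan (mul_mem v.2 w.2)
  | zero_left b _ => rw [zero_mul]; exact zero_mem _
  | zero_right a _ => rw [mul_zero]; exact zero_mem _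
  | add_left a b c _ _ _ h h' => rw [add_mul]; exact add_mem h h'
  | add_right a b c _ _ _ h h' => rw [mul_add]; exact add_mem h h'
  | smul_left k a b _ _ h => rw [smul_mul_assoc]; exact Submodule.smul_mem _ k h
  | smul_right k a b _ _ h => rw [mul_smul_comm]; exact Submodule.smul_mem _ k h

/-- On a single letter `D` raises the index; on a product the Leibniz rule involves only the two
factors and their derivatives, all already in the span. -/
theorem opD_mem_monomialSpan {a : Quo (diffRel X lam)} (ha : a ∈ monomialSpan X lam) :
    Quo.opD _ a ∈ monomialSpan X lam := by
  induction ha using Submodule.span_induction with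
  | mem a h =>
    obtain ⟨⟨w, hw⟩, rfl⟩ := h
    dsimp only
    induction hw using Subsemigroup.closure_induction with
    | mem w h =>
      rw [Quo.opD_mk, opD_word]
      exact mk_word_mem_monomialSpan (Subsemigroup.subset_closure (op_mem_DOmega h))
    | mul v w hv hw ihv ihw =>
      have hv := mk_word_mem_monomialSpan (lam := lam) hv
      have hw := mk_word_mem_monomialSpan (lam := lam) hw
      rw [word_mul, Quo.mk_mul, isLamDiff_opD]
      exact add_mem (add_mem (mul_mem_monomialSpan ihv hw) (mul_mem_monomialSpan hv ihw))
        (Submodule.smul_mem _ _ (mul_mem_monomialSpan ihv ihw))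
  | zero => rw [map_zero]; exact zero_mem _
  | add a b _ _ ha hb => rw [map_add]; exact add_mem ha hb
  | smul k a _ ha => rw [map_smul]; exact Submodule.smul_mem _ k ha

theorem top_le_monomialSpan : ⊤ ≤ monomialSpan X lam := by
  rintro a -
  obtain ⟨a, rfl⟩ := Quo.mk_surjective _ a
  induction a using poly_induction with
  | zero => rw [map_zero]; exact zero_mem _
  | add a b ha hb => rw [map_add]; exact add_mem ha hb
  | smul k a ha => rw [map_smul]; exact Submodule.smul_mem _ k ha
  | word w =>
    induction w using Word.inductionOn with
    | var x => exact mk_word_mem_monomialSpan (iter_mem 0 x)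
    | op w ih => rw [← opD_word, ← Quo.opD_mk]; exact opD_mem_monomialSpan ih
    | mul v w ihv ihw => rw [word_mul, Quo.mk_mul]; exact mul_mem_monomialSpan ihv ihw

end CommDiff

open CommDiff in
theorem theorem5p2 {K : Type*} [CommRing K] [Nontrivial K] (lam : K)
    {X : Type*} [LinearOrder X] [WellFoundedLT X] :
    -- `Irr(S) = CS(D^ω(X))`
    Irr (diffRel X lam) = (Word.CSDOmega X : Set (Word X)) ∧
    -- `CS(D^ω(X))` is the free commutative semigroup on the letters `D^i(x)`
    (∀ (G : Type*) [CommSemigroup G] (f : ℕ → X → G),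
      ∃! φ : Word.CSDOmega X →ₙ* G,
        ∀ i x, φ ⟨Word.iter i x, Word.iter_mem i x⟩ = f i x) ∧
    -- it is a `K`-basis of `K[X;D|S]`
    (∃ b : Module.Basis (Word.CSDOmega X) K (Quo (diffRel X lam)),
      ∀ w : Word.CSDOmega X, b w = Quo.mk (diffRel X lam) (word K (w : Word X))) ∧
    -- `K[X;D|S]` is the free commutative `λ`-differential algebra on `X`
    IsLamDiff lam (Quo.opD (diffRel X lam)) ∧
    (∀ (R : Type*) [NonUnitalCommRing R] [Module K R] [IsScalarTower K R R]
      [SMulCommClass K R R] (d : R →ₗ[K] R), IsLamDiff lam d → ∀ φ : X → R,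
      ∃! f : Quo (diffRel X lam) →ₙₐ[K] R,
        (∀ a, f (Quo.opD (diffRel X lam) a) = d (f a)) ∧
        ∀ x, f (Quo.mk (diffRel X lam) (word K (Word.var x))) = φ x) := by
  refine ⟨irr_diffRel lam, fun G _ f => Word.existsUnique_mulHom f,
    ⟨.mk (linearIndependent_mk_word lam) top_le_monomialSpan, fun w => ?_⟩, isLamDiff_opD lam,
    fun R _ _ _ _ d hd φ => existsUnique_quo_hom φ hd⟩
  exact Module.Basis.mk_apply _ _ w
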